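/- Let $\mathbb T^2=\mathbb R^2/\mathbb Z^2$, with Lebesgue probability measure $\mathrm{vol}$, let $T^*\mathbb T^2=\mathbb T^2\times\mathbb R^2$ with projection $\Pi(x,\xi)=x$, and let $V\in C^\infty(\mathbb T^2;\mathbb R)$. Let $\Lambda\subset\mathbb Z^2$ be a primitive sublattice of rank $1$ (its real span $\langle\Lambda\rangle$ is a line and $\langle\Lambda\rangle\cap\mathbb Z^2=\Lambda$), let $\mathfrak e_\Lambda$ be a generator of $\Lambda$, let $L_\Lambda=\|\mathfrak e_\Lambda\|$, and let $\mathfrak e_\Lambda^\perp$ be the vector of the same length that is directly orthogonal to $\mathfrak e_\Lambda$. Put $$H_\Lambda(x,\xi)=\tfrac1{L_\Lambda}\langle\xi,\mathfrak e_\Lambda\rangle,\qquad H_\Lambda^\perp(x,\xi)=\tfrac1{L_\Lambda}\langle\xi,\mathfrak e_\Lambda^\perp\rangle,$$ $$\mathcal I_\Lambda(V)(x)=\tfrac1{L_\Lambda}\int_0^{L_\Lambda}V\Big(x+s\tfrac{\mathfrak e_\Lambda^\perp}{L_\Lambda}\Big)\,ds,\qquad p_\Lambda(x,\xi)=\tfrac12H_\Lambda(x,\xi)^2+\mathcal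 I_\Lambda(V)(x),$$ let $\varphi^t_{H_\Lambda^\perp}$ and $\varphi^t_{p_\Lambda}$ be the Hamiltonian flows of $H_\Lambda^\perp$ and $p_\Lambda$ on $T^*\mathbb T^2$, and put $$\mathrm{Crit}_\Lambda(V)=\{(x,\xi)\in T^*\mathbb T^2:\ H_\Lambda(x,\xi)=0\ \text{and}\ \partial_x\mathcal I_\Lambda(V)(x)=0\}.$$ For an orbit $\Gamma$ of $\varphi_{H_\Lambda^\perp}$ let $\delta_{\Pi\circ\Gamma}$ be the uniform probability measure (normalized length measure) on the closed geodesic $\Pi(\Gamma)$, and let $\mathcal N(\Lambda)$ be the closed convex hull, for the weak topology of finite measures on $\mathbb T^2$, of the measures $\delta_{\Pi\circ\Gamma}$ where $\Gamma$ ranges over the orbits of $\varphi_{H_\Lambda^\perp}$ contained in $\mathrm{Crit}_\Lambda(V)$. Let $\mu$ be a (Borel) probability measure on $T^*\mathbb T^2$ that is invariant under $\varphi^t_{H_\Lambda^\perp}$ and $\varphi^t_{p_\Lambda}$ for all $t\in\mathbb R$. Then there are a nonnegative $f\in L^1(\mathbb T^2,\mathrm{vol})$, a number $\alpha\in[0,1]$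 and a measure $\nu_{\mathrm{sing}}\in\mathcal N(\Lambda)$ such that $$\Pi_*\mu=f\,\mathrm{vol}+\alpha\,\nu_{\mathrm{sing}}.$$ -/

import Mathlib

open MeasureTheory Set Filter Topology
open scoped NNReal ContDiff RealInnerProductSpace

noncomputable section

namespace TorusBiinv

/-- The Euclidean plane `ℝ²`. -/
abbrev Plane : Type := EuclideanSpace ℝ (Fin 2)

/-- The rational torus `𝕋² = ℝ² / ℤ²`, with its Lebesgue (Haar) probability measure `volume`. -/
abbrev Torus : Type := Fin 2 → UnitAddCircle

/-- The cotangent bundle `T*𝕋² = 𝕋² × ℝ²`; its points are written `(x, ξ)`. -/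
abbrev Phase : Type := Torus × Plane

/-- The canonical projection `ℝ² → 𝕋²`. -/
def proj (v : Plane) : Torus := fun i => (v i : UnitAddCircle)

/-- `V : 𝕋² → ℝ` is smooth: its lift to a `ℤ²`-periodic function on `ℝ²` is smooth. -/
def SmoothOnTorus (V : Torus → ℝ) : Prop :=
  ContDiff ℝ ∞ (fun v : Plane => V (proj v))

/-- The gradient `∂ₓ g (x)` of a function `g` on the torus, for the flat metric. -/
def torusGrad (g : Torus → ℝ) (x : Torus) : Plane :=
  gradient (fun v : Plane => g (x + proj v)) 0

/-! ### Hamiltonian flows on `T*𝕋²` -/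

/-- The Hamiltonian vector field `(∂_ξ h, -∂ₓ h)` of `h` for the canonical symplectic form. -/
def hamField (h : Phase → ℝ) (z : Phase) : Plane × Plane :=
  (gradient (fun ξ : Plane => h (z.1, ξ)) z.2, -torusGrad (fun x => h (x, z.2)) z.1)

/-- `φ` is the (complete) flow of the vector field `X` on `T*𝕋²`: each curve `t ↦ φ t (x, ξ)` starts
at `(x, ξ)` and solves the differential equation of `X`. The curve `c` below is its lift to
`ℝ² × ℝ²`, with first component taken relative to the starting point. -/
def IsFlow (X : Phase → Plane × Plane) (φ : ℝ → Phase → Phase) : Prop :=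
  ∀ z : Phase, ∃ c : ℝ → Plane × Plane, c 0 = (0, z.2) ∧
    ∀ t : ℝ, φ t z = (z.1 + proj (c t).1, (c t).2) ∧ HasDerivAt c (X (φ t z)) t

open Classical in
/-- The Hamiltonian flow `φ_h^t` of `h` (the identity if `h` has no complete flow). -/
def hamFlow (h : Phase → ℝ) : ℝ → Phase → Phase :=
  if H : ∃ φ, IsFlow (hamField h) φ then H.choose else fun _ z => z

/-! ### Primitive lattices of rank one and the associated Hamiltonians -/

/-- The inclusion `ℤ² → ℝ²`. -/
def latVec (k : Fin 2 → ℤ) : Plane := !₂[(k 0 : ℝ), (k 1 : ℝ)]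

/-- `Λ` is a primitive sublattice of `ℤ²` of rank one: its real span `⟨Λ⟩` is a line, and
`⟨Λ⟩ ∩ ℤ² = Λ`. -/
def IsPrimitiveRankOne (Λ : AddSubgroup (Fin 2 → ℤ)) : Prop :=
  Module.finrank ℝ (Submodule.span ℝ (latVec '' (Λ : Set (Fin 2 → ℤ)))) = 1 ∧
    ∀ k : Fin 2 → ℤ, latVec k ∈ Submodule.span ℝ (latVec '' (Λ : Set (Fin 2 → ℤ))) → k ∈ Λ

/-- The vector `𝔢^⊥`, of the same length as `𝔢` and directly orthogonal to it. -/
def latPerp (e : Fin 2 → ℤ) : Plane := !₂[-(e 1 : ℝ), (e 0 : ℝ)]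

/-- The length `L_Λ = ‖𝔢_Λ‖`. -/
def latLen (e : Fin 2 → ℤ) : ℝ := ‖latVec e‖

/-- `H_Λ(x, ξ) = ⟨ξ, 𝔢_Λ⟩ / L_Λ`. -/
def HLam (e : Fin 2 → ℤ) (z : Phase) : ℝ := (1 / latLen e) * ⟪z.2, latVec e⟫

/-- `H_Λ^⊥(x, ξ) = ⟨ξ, 𝔢_Λ^⊥⟩ / L_Λ`. -/
def HPerp (e : Fin 2 → ℤ) (z : Phase) : ℝ := (1 / latLen e) * ⟪z.2, latPerp e⟫

/-- The average `I_Λ(V)(x)` of `V` along the closed geodesic through `x` directed by `𝔢_Λ^⊥`. -/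
def avg (e : Fin 2 → ℤ) (V : Torus → ℝ) (x : Torus) : ℝ :=
  (1 / latLen e) * ∫ s in (0 : ℝ)..latLen e, V (x + proj ((s / latLen e) • latPerp e))

/-- `p_Λ = H_Λ² / 2 + I_Λ(V)`, as a function on `T*𝕋²`. -/
def pLam (e : Fin 2 → ℤ) (V : Torus → ℝ) (z : Phase) : ℝ :=
  HLam e z ^ 2 / 2 + avg e V z.1

/-- The critical set `Crit_Λ(V)`. -/
def Crit (e : Fin 2 → ℤ) (V : Torus → ℝ) : Set Phase :=
  {z | HLam e z = 0 ∧ torusGrad (avg e V) z.1 = 0}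

/-! ### Uniform measures on projected orbits -/

/-- The uniform probability measure `δ_{Π∘Γ}` on the projection to `𝕋²` of the orbit `Γ` of `z` under
the flow of `H_Λ^⊥`. This closed geodesic is traversed at unit speed and has length `L_Λ`, so the
measure is the image of the normalized Lebesgue measure on `(0, L_Λ]`. -/
def orbitMeasure (e : Fin 2 → ℤ) (z : Phase) : Measure Torus :=
  (ENNReal.ofReal (latLen e))⁻¹ •
    (volume.restrict (Ioc 0 (latLen e))).map (fun s : ℝ => (hamFlow (HPerp e) s z).1)

/-- The set `𝒩(Λ)`: the closed convex hull, for the weak topology of finite measures on `𝕋²`, of the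
measures `δ_{Π∘Γ}`, where `Γ` ranges over the orbits of `H_Λ^⊥` contained in `Crit_Λ(V)`. -/
def NLam (e : Fin 2 → ℤ) (V : Torus → ℝ) : Set (FiniteMeasure Torus) :=
  closure (convexHull ℝ≥0
    {m : FiniteMeasure Torus | ∃ z : Phase, (∀ s : ℝ, hamFlow (HPerp e) s z ∈ Crit e V) ∧
      (m : Measure Torus) = orbitMeasure e z})

/-! ### Completeness: the flows of `H_Λ^⊥` and of `p_Λ` exist for all times -/

theorem hasFDerivAt_lineAvg {F : Type*} [NormedAddCommGroup F] [NormedSpace ℝ F]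
    [CompleteSpace F] {g : Plane → F} (hg : ContDiff ℝ 1 g) (u : Plane) (L : ℝ) (v : Plane) :
    HasFDerivAt (fun v : Plane => ∫ s in (0 : ℝ)..L, g (v + s • u))
      (∫ s in (0 : ℝ)..L, fderiv ℝ g (v + s • u)) v := by
  have hgc : Continuous g := hg.continuous
  have hg' : Continuous (fderiv ℝ g) := hg.continuous_fderiv one_ne_zero
  have hK : IsCompact (Metric.closedBall v 1 ×ˢ uIcc (0 : ℝ) L) :=
    (isCompact_closedBall v 1).prod isCompact_uIcc
  obtain ⟨C, hC⟩ := hK.exists_bound_of_continuousOn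
    (f := fun q : Plane × ℝ => fderiv ℝ g (q.1 + q.2 • u)) (by fun_prop)
  refine intervalIntegral.hasFDerivAt_integral_of_dominated_of_fderiv_le
    (F' := fun v s => fderiv ℝ g (v + s • u)) (bound := fun _ => C)
    (Metric.closedBall_mem_nhds v one_pos) ?_ ?_ ?_ ?_ ?_ ?_
  · exact Eventually.of_forall fun x => (by fun_prop : Continuous _).aestronglyMeasurable
  · exact (by fun_prop : Continuous _).intervalIntegrable _ _
  · have hc : Continuous fun s : ℝ => fderiv ℝ g (v + s • u) := by fun_prop
    exact hc.aestronglyMeasurable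
  · exact Eventually.of_forall fun t ht x hx => hC (x, t) ⟨hx, uIoc_subset_uIcc ht⟩
  · exact intervalIntegrable_const
  · refine Eventually.of_forall fun t ht x hx => ?_
    have h := (hg.differentiable one_ne_zero (x + t • u)).hasFDerivAt
    have h' := HasFDerivAt.comp x h ((hasFDerivAt_id x).add_const (t • u))
    rwa [ContinuousLinearMap.comp_id] at h'

theorem contDiff_lineAvg (n : ℕ) : ∀ {F : Type} [NormedAddCommGroup F] [NormedSpace ℝ F]
    [CompleteSpace F] {g : Plane → F}, ContDiff ℝ n g → ∀ (u : Plane) (L : ℝ),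
    ContDiff ℝ n (fun v : Plane => ∫ s in (0 : ℝ)..L, g (v + s • u)) := by
  induction n with
  | zero =>
    intro F _ _ _ g hg u L
    rw [Nat.cast_zero, contDiff_zero] at *
    exact intervalIntegral.continuous_parametric_intervalIntegral_of_continuous'
      (by simp only [Function.uncurry_def]; fun_prop) _ _
  | succ n ih =>
    intro F _ _ _ g hg u L
    rw [Nat.cast_succ] at *
    rw [contDiff_succ_iff_hasFDerivAt]
    exact ⟨_, ih (hg.fderiv_right le_rfl) u L,
      fun v => hasFDerivAt_lineAvg (hg.of_le (by norm_cast; omega)) u L v⟩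

theorem proj_add (v w : Plane) : proj (v + w) = proj v + proj w := by
  ext i; simp [proj]

theorem proj_surjective : Function.Surjective proj := by
  intro x
  choose v hv using fun i => QuotientAddGroup.mk_surjective (x i)
  exact ⟨WithLp.toLp 2 v, funext hv⟩

theorem contDiff_avg {V : Torus → ℝ} (hV : SmoothOnTorus V) (e : Fin 2 → ℤ) :
    ContDiff ℝ 2 (fun v : Plane => avg e V (proj v)) := by
  have h := (contDiff_lineAvg 2 (contDiff_infty.1 hV 2)
    ((1 / latLen e) • latPerp e) (latLen e)).const_smul (1 / latLen e)
  refine Eq.mp (congrArg _ (funext fun v => ?_)) h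
  simp only [avg, smul_eq_mul, ← proj_add, smul_smul, mul_one_div]

theorem torusGrad_proj (g : Torus → ℝ) (w : Plane) :
    torusGrad g (proj w) = gradient (fun v : Plane => g (proj v)) w := by
  simp only [torusGrad, gradient, ← proj_add]
  rw [fderiv_comp_add_left (f := fun v : Plane => g (proj v)) w, add_zero]

theorem contDiff_torusGrad_proj {V : Torus → ℝ} (hV : SmoothOnTorus V) (e : Fin 2 → ℤ) :
    ContDiff ℝ 1 (fun w : Plane => torusGrad (avg e V) (proj w)) := by
  simp only [torusGrad_proj, gradient]
  exact (InnerProductSpace.toDual ℝ Plane).symm.contDiff.comp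
    ((contDiff_avg hV e).fderiv_right (m := 1) (by norm_num))

theorem exists_bound_torusGrad {V : Torus → ℝ} (hV : SmoothOnTorus V) (e : Fin 2 → ℤ) :
    ∃ M : ℝ, ∀ x, ‖torusGrad (avg e V) x‖ ≤ M := by
  obtain ⟨M, hM⟩ := (isCompact_closedBall (0 : Plane) 2).exists_bound_of_continuousOn
    (contDiff_torusGrad_proj hV e).continuous.continuousOn
  refine ⟨M, fun x => ?_⟩
  obtain ⟨w, rfl⟩ := proj_surjective x
  have : proj w = proj (WithLp.toLp 2 fun i => Int.fract (w i)) := by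
    ext i
    simp only [proj, Int.fract]
    have hz : ((⌊w i⌋ : ℝ) : UnitAddCircle) = 0 :=
      (AddCircle.coe_eq_zero_iff (1 : ℝ)).2 ⟨⌊w i⌋, by simp⟩
    rw [AddCircle.coe_sub, hz, sub_zero]
  rw [this]
  refine hM _ ?_
  rw [mem_closedBall_zero_iff, EuclideanSpace.norm_eq, Fin.sum_univ_two]
  refine Real.sqrt_le_iff.2 ⟨by norm_num, ?_⟩
  have h0 := Int.fract_nonneg (w 0)
  have h1 := Int.fract_nonneg (w 1)
  have h2 := (Int.fract_lt_one (w 0)).le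
  have h3 := (Int.fract_lt_one (w 1)).le
  simp only [Real.norm_eq_abs, sq_abs]
  nlinarith

theorem hasFDerivAt_inner_right (u ξ : Plane) :
    HasFDerivAt (fun ξ : Plane => ⟪ξ, u⟫) (innerSL ℝ u) ξ := by
  have h : (fun ξ : Plane => ⟪ξ, u⟫) = innerSL ℝ u := funext fun ξ => real_inner_comm _ _
  rw [h]
  exact (innerSL ℝ u).hasFDerivAt

theorem hamField_HPerp (e : Fin 2 → ℤ) (z : Phase) :
    hamField (HPerp e) z = ((1 / latLen e) • latPerp e, 0) := by
  have h : HasGradientAt (fun ξ : Plane => (1 / latLen e) * ⟪ξ, latPerp e⟫)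
      ((1 / latLen e) • latPerp e) z.2 := by
    rw [hasGradientAt_iff_hasFDerivAt]
    refine ((hasFDerivAt_inner_right (latPerp e) z.2).const_mul (1 / latLen e)).congr_fderiv ?_
    ext ξ
    simp
  have h2 : torusGrad (fun x : Torus => HPerp e (x, z.2)) z.1 = 0 := by
    simp [torusGrad, HPerp, gradient]
  simp only [hamField, h2, neg_zero]
  simp only [HPerp]
  rw [h.gradient]

theorem hamField_pLam (e : Fin 2 → ℤ) (V : Torus → ℝ) (z : Phase) :
    hamField (pLam e V) z =
      ((HLam e z / latLen e) • latVec e, -torusGrad (avg e V) z.1) := by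
  have h : HasGradientAt (fun ξ : Plane => ((1 / latLen e) * ⟪ξ, latVec e⟫) ^ 2 / 2 + avg e V z.1)
      ((HLam e z / latLen e) • latVec e) z.2 := by
    rw [hasGradientAt_iff_hasFDerivAt]
    refine (((((hasFDerivAt_inner_right (latVec e) z.2).const_mul (1 / latLen e)).pow 2).mul_const
      (2⁻¹ : ℝ)).add_const (avg e V z.1)).congr_fderiv ?_
    ext ξ
    simp [HLam]
    ring
  have h2 : torusGrad (fun x : Torus => pLam e V (x, z.2)) z.1 = torusGrad (avg e V) z.1 := by
    simp only [torusGrad, pLam, HLam, gradient]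
    rw [fderiv_const_add]
  simp only [hamField, h2]
  simp only [pLam, HLam]
  rw [h.gradient]
  rfl

theorem exists_isFlow_HPerp (e : Fin 2 → ℤ) : ∃ φ, IsFlow (hamField (HPerp e)) φ := by
  refine ⟨fun t z => (z.1 + proj (t • ((1 / latLen e) • latPerp e)), z.2), fun z =>
    ⟨fun t => (t • ((1 / latLen e) • latPerp e), z.2), by simp, fun t => ⟨rfl, ?_⟩⟩⟩
  rw [hamField_HPerp]
  have h := (hasDerivAt_id t).smul_const ((1 / latLen e) • latPerp e)
  rw [one_smul] at h
  exact h.prodMk (hasDerivAt_const t z.2)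

open scoped Manifold in
/-- A `C¹` vector field whose integral curves all live for a common time is complete. -/
theorem exists_curve {E : Type*} [NormedAddCommGroup E] [NormedSpace ℝ E] [CompleteSpace E]
    {F : E → E} (hF : ContDiff ℝ 1 F) {ε : ℝ} (hε : 0 < ε)
    (h : ∀ x, ∃ γ : ℝ → E, γ 0 = x ∧ ∀ t ∈ Ioo (-ε) ε, HasDerivAt γ (F (γ t)) t) (x : E) :
    ∃ γ : ℝ → E, γ 0 = x ∧ ∀ t, HasDerivAt γ (F (γ t)) t := by
  obtain ⟨γ, h0, hγ⟩ := exists_isMIntegralCurve_of_isMIntegralCurveOn (I := 𝓘(ℝ, E)) (M := E)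
    (v := F) (contMDiff_vectorSpace_iff_contDiff.2 hF) hε (fun x => by
      obtain ⟨γ, h0, hγ⟩ := h x
      exact ⟨γ, h0, fun t ht => ((hγ t ht).hasFDerivAt.hasMFDerivAt).hasMFDerivWithinAt⟩) x
  exact ⟨γ, h0, fun t => (hasDerivAt_iff_hasFDerivAt.2 (hγ t).hasFDerivAt)⟩

theorem exists_isFlow_pLam {V : Torus → ℝ} (hV : SmoothOnTorus V) (e : Fin 2 → ℤ) :
    ∃ φ, IsFlow (hamField (pLam e V)) φ := by
  obtain ⟨M, hM⟩ := exists_bound_torusGrad hV e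
  have hM0 : 0 ≤ M := (norm_nonneg _).trans (hM 0)
  suffices H : ∀ z : Phase, ∃ c : ℝ → Plane × Plane, c 0 = (0, z.2) ∧ ∀ t,
      HasDerivAt c (hamField (pLam e V) (z.1 + proj (c t).1, (c t).2)) t by
    choose c h0 hc using H
    exact ⟨fun t z => (z.1 + proj (c z t).1, (c z t).2), fun z => ⟨c z, h0 z, fun t =>
      ⟨rfl, hc z t⟩⟩⟩
  rintro ⟨x, ξ⟩
  obtain ⟨w, rfl⟩ := proj_surjective x
  let F : Plane × Plane → Plane × Plane := fun q => hamField (pLam e V) (proj w + proj q.1, q.2)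
  have hF : ∀ q, F q = (((1 / latLen e) * ⟪q.2, latVec e⟫ / latLen e) • latVec e,
      -torusGrad (avg e V) (proj (w + q.1))) := fun q => by
    simp only [F, hamField_pLam, proj_add, HLam]
  have hFc : ContDiff ℝ 1 F := by
    rw [funext hF]
    have := contDiff_torusGrad_proj hV e
    exact ContDiff.prodMk
      ((((contDiff_snd.inner ℝ contDiff_const).const_smul (1 / latLen e)).div_const _).smul
        contDiff_const) ((this.comp (by fun_prop :
      ContDiff ℝ 1 fun q : Plane × Plane => w + q.1)).neg)
  have hb : ∀ q, ‖F q‖ ≤ ‖q‖ + M := fun q => by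
    rw [hF, Prod.norm_def]
    refine max_le ?_ ?_
    · have h1 : ‖q.2‖ ≤ ‖q‖ := norm_snd_le q
      have h2 : ‖((1 / latLen e) * ⟪q.2, latVec e⟫ / latLen e) • latVec e‖ ≤ ‖q.2‖ := by
        rcases (norm_nonneg (latVec e)).eq_or_lt with h | h
        · rw [norm_smul, ← h, mul_zero]; exact norm_nonneg _
        · have h3 := abs_real_inner_le_norm q.2 (latVec e)
          rw [norm_smul, norm_div, norm_mul, norm_div]
          simp only [latLen, norm_norm, norm_one, Real.norm_eq_abs (inner ℝ _ _)]
          field_simp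
          nlinarith
      exact (h2.trans h1).trans (by linarith)
    · rw [norm_neg]
      exact (hM _).trans (by linarith [norm_nonneg q])
  refine exists_curve hFc (ε := 1 / 2) (by norm_num) (fun q => ?_) (0, ξ)
  have ha : 0 ≤ ‖q‖ + M := by positivity
  obtain ⟨K, hK⟩ := LocallyLipschitzOn.exists_lipschitzOnWith_of_compact
    (isCompact_closedBall q (‖q‖ + M)) (hFc.locallyLipschitz.locallyLipschitzOn (s := _))
  have hPL : IsPicardLindelof (fun _ => F) (tmin := -(1 / 2)) (tmax := 1 / 2)
      ⟨0, by norm_num⟩ q ⟨‖q‖ + M, ha⟩ 0 ⟨2 * (‖q‖ + M), by positivity⟩ K := by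
    refine IsPicardLindelof.of_time_independent (fun y hy => ?_) hK ?_
    · have h1 : ‖y‖ ≤ ‖q‖ + (‖q‖ + M) := by
        have := norm_le_norm_add_norm_sub' y q
        have h2 : ‖y - q‖ ≤ ‖q‖ + M := mem_closedBall_iff_norm.1 hy
        linarith
      refine (hb y).trans ?_
      change _ ≤ 2 * (‖q‖ + M)
      linarith
    · change 2 * (‖q‖ + M) * _ ≤ ‖q‖ + M - 0
      norm_num
      linarith
  obtain ⟨γ, h0, hγ⟩ := hPL.exists_eq_forall_mem_Icc_hasDerivWithinAt₀
  exact ⟨γ, h0, fun t ht =>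
    (hγ t (Ioo_subset_Icc_self ht)).hasDerivAt (Icc_mem_nhds ht.1 ht.2)⟩

/-- `hamFlow (pLam e V)` is the Hamiltonian flow of `p_Λ`. -/
theorem isFlow_hamFlow_pLam {V : Torus → ℝ} (hV : SmoothOnTorus V) (e : Fin 2 → ℤ) :
    IsFlow (hamField (pLam e V)) (hamFlow (pLam e V)) := by
  have H := exists_isFlow_pLam hV e
  rw [hamFlow, dif_pos H]
  exact H.choose_spec

/-- `hamFlow (HPerp e)` is the Hamiltonian flow of `H_Λ^⊥`. -/
theorem isFlow_hamFlow_HPerp (e : Fin 2 → ℤ) :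
    IsFlow (hamField (HPerp e)) (hamFlow (HPerp e)) := by
  have H := exists_isFlow_HPerp e
  rw [hamFlow, dif_pos H]
  exact H.choose_spec

/-- Explicit formula: `φ^t (x, ξ) = (x + t 𝔢_Λ^⊥ / L_Λ, ξ)` for the flow of `H_Λ^⊥`. -/
theorem hamFlow_HPerp (e : Fin 2 → ℤ) (t : ℝ) (z : Phase) :
    hamFlow (HPerp e) t z = (z.1 + proj (t • ((1 / latLen e) • latPerp e)), z.2) := by
  obtain ⟨c, h0, hc⟩ := isFlow_hamFlow_HPerp e z
  let u : Plane × Plane := ((1 / latLen e) • latPerp e, 0)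
  have hd : ∀ t, HasDerivAt (fun t => c t - t • u) 0 t := fun t => by
    have h1 := (hc t).2
    rw [hamField_HPerp] at h1
    have h2 := h1.sub ((hasDerivAt_id t).smul_const u)
    rwa [one_smul, sub_self] at h2
  have h3 := is_const_of_deriv_eq_zero (fun t => (hd t).differentiableAt) (fun t => (hd t).deriv) t 0
  have h4 : c t = (0, z.2) + t • u := by
    rw [← h0, ← sub_eq_iff_eq_add]
    simpa using h3
  rw [(hc t).1, h4]
  simp [u]

end TorusBiinv

end

noncomputable section

namespace TorusBiinv

/-! ### Convex combinations with nonnegative real weights -/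

/-! Split `μ` into its restrictions to `Crit e V` and to the complement; the first projects to the
singular term, the second to the density.

Off the critical set, let `N` be a null set of the torus. Moving a point `z` for time `t` by the
flow of `p_Λ` and then for time `s` by that of `H_Λ^⊥` displaces its base point by `y(t)` along `𝔢`
and by `s` along `𝔢^⊥`, where `y' = H_Λ` along the first orbit. Where `H_Λ ≠ 0`, `t ↦ y(t)` is
locally a diffeomorphism, so almost every such `t` gives a line meeting `N` in a null set of `s`.
Zeros of `H_Λ` with nonzero derivative are isolated. At the other zeros the gradient of the average
vanishes and the orbit is critical. This is `orbit_noncritical_null`. Fubini and the invariance of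
`μ` turn it into `measure_noncritical_null`, which is absolute continuity.

On the critical set, the projected measure is invariant under translation along `𝔢^⊥`. Once
normalized, it gives a continuous function and its average along these geodesics the same integral
(`integral_avg`), so it is a barycenter of orbit measures through critical points. Discretizing the
barycenter gives finite convex combinations converging weakly to it, whence `mem_NLam_of_invariant`.
-/

/-- Finite measures have no subtraction, so `E` is only a semimodule. Leaving the total weight free
lets the induction run without renormalizing the smaller sum. -/
theorem exists_mem_sum_smul_eq {E ι : Type*} [AddCommMonoid E] [Module ℝ≥0 E] {S : Set E}
    (hS : Convex ℝ≥0 S) (hne : S.Nonempty) (t : Finset ι) (w : ι → ℝ≥0) (z : ι → E)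
    (hz : ∀ i ∈ t, z i ∈ S) : ∃ p ∈ S, ∑ i ∈ t, w i • z i = (∑ i ∈ t, w i) • p := by
  classical
  induction t using Finset.induction_on with
  | empty => obtain ⟨p, hp⟩ := hne; exact ⟨p, hp, by simp⟩
  | insert a t ha ih =>
    obtain ⟨p, hp, h⟩ := ih fun i hi => hz i (Finset.mem_insert_of_mem hi)
    rw [Finset.sum_insert ha, Finset.sum_insert ha, h]
    set W := ∑ i ∈ t, w i
    by_cases h0 : w a + W = 0
    · obtain ⟨h1, h2⟩ := add_eq_zero.1 h0
      exact ⟨p, hp, by simp [h1, h2]⟩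
    · refine ⟨(w a / (w a + W)) • z a + (W / (w a + W)) • p,
        hS (hz a (Finset.mem_insert_self a t)) hp (zero_le) (zero_le) ?_, ?_⟩
      · rw [← add_div, div_self h0]
      · rw [smul_add, smul_smul, smul_smul, mul_div_cancel₀ _ h0, mul_div_cancel₀ _ h0]

theorem sum_smul_mem_of_convex {E ι : Type*} [AddCommMonoid E] [Module ℝ≥0 E] {S : Set E}
    (hS : Convex ℝ≥0 S) (t : Finset ι) (w : ι → ℝ≥0) (z : ι → E) (hw : ∑ i ∈ t, w i = 1)
    (hz : ∀ i ∈ t, z i ∈ S) : ∑ i ∈ t, w i • z i ∈ S := by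
  have hne : t.Nonempty := by
    rw [Finset.nonempty_iff_ne_empty]
    rintro rfl
    simp at hw
  obtain ⟨i, hi⟩ := hne
  obtain ⟨p, hp, h⟩ := exists_mem_sum_smul_eq hS ⟨z i, hz i hi⟩ t w z hz
  rwa [h, hw, one_smul]

/-! ### Null sets and the projection `ℝ² → 𝕋²` -/

/-- Countably many unit boxes cover the plane, and the quotient map preserves measure on each. -/
theorem quasiMeasurePreserving_proj : Measure.QuasiMeasurePreserving proj volume volume := by
  have hm : Measurable proj := by
    refine measurable_pi_lambda _ fun i => ?_
    exact (AddCircle.measurable_mk' (a := (1 : ℝ))).comp (by fun_prop)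
  refine ⟨hm, Measure.AbsolutelyContinuous.mk fun N hN h0 => ?_⟩
  rw [Measure.map_apply hm hN]
  let Q : (Fin 2 → ℝ) → Torus := fun a i => (a i : UnitAddCircle)
  have hQ : MeasurableSet (Q ⁻¹' N) :=
    hN.preimage (measurable_pi_lambda _ fun i =>
      (AddCircle.measurable_mk' (a := (1 : ℝ))).comp (measurable_pi_apply i))
  have hv : volume (proj ⁻¹' N) = volume (Q ⁻¹' N) :=
    (PiLp.volume_preserving_ofLp (Fin 2)).measure_preimage hQ.nullMeasurableSet
  rw [hv]
  have hcov : Q ⁻¹' N ⊆ ⋃ k : Fin 2 → ℤ,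
      (Q ⁻¹' N) ∩ Set.pi univ fun i => Ioc (k i : ℝ) (k i + 1) := by
    intro a ha
    -- The boxes are open on the left, hence the ceiling minus one rather than the floor.
    refine mem_iUnion.2 ⟨fun i => ⌈a i⌉ - 1, ha, fun i _ => ⟨?_, ?_⟩⟩
    · push_cast
      linarith [Int.ceil_lt_add_one (a i)]
    · push_cast
      linarith [Int.le_ceil (a i)]
  refine measure_mono_null hcov (measure_iUnion_null fun k => ?_)
  have hp := measurePreserving_pi
    (fun i => (volume : Measure ℝ).restrict (Ioc (k i : ℝ) (k i + 1)))
    (fun _ : Fin 2 => (volume : Measure UnitAddCircle))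
    (f := fun _ (a : ℝ) => (a : UnitAddCircle))
    (fun i => UnitAddCircle.measurePreserving_mk (k i))
  have h1 := hp.measure_preimage hN.nullMeasurableSet
  rw [← Measure.restrict_apply hQ, volume_pi, Measure.restrict_pi_pi]
  refine Eq.trans ?_ (h1.trans h0)
  rfl

/-! ### One-dimensional preimages of null sets -/

/-- Near a point with `h ≠ 0`, Rolle's theorem makes `y` injective. By the change of variables
formula, `|h|` then has integral zero over the local preimage of `B`; as `|h| > 0` there, this
preimage is null. -/
theorem volume_preimage_null_of_deriv_ne_zero {y h : ℝ → ℝ} (hy : ∀ t, HasDerivAt y (h t) t)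
    (hh : Continuous h) {B : Set ℝ} (hB : MeasurableSet B) (hB0 : volume B = 0) :
    volume {t | h t ≠ 0 ∧ y t ∈ B} = 0 := by
  have hyc : Continuous y := continuous_iff_continuousAt.2 fun t => (hy t).continuousAt
  refine measure_null_of_locally_null _ fun t ht => ?_
  obtain ⟨r, hr, hball⟩ := Metric.mem_nhds_iff.1 ((isOpen_ne.preimage hh).mem_nhds ht.1)
  have hinj : InjOn y (Metric.ball t r) := by
    intro a ha b hb hab
    by_contra hne
    wlog hlt : a < b generalizing a b
    · exact this hb ha hab.symm (Ne.symm hne) (lt_of_le_of_ne (not_lt.1 hlt) (Ne.symm hne))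
    obtain ⟨c, hc, hc0⟩ := exists_hasDerivAt_eq_zero hlt hyc.continuousOn hab fun x _ => hy x
    refine hball ?_ hc0
    have := (convex_ball t r).ordConnected.out ha hb
    exact this (Ioo_subset_Icc_self hc)
  have hs : MeasurableSet (Metric.ball t r ∩ y ⁻¹' B) :=
    Metric.isOpen_ball.measurableSet.inter (hB.preimage hyc.measurable)
  refine ⟨Metric.ball t r ∩ y ⁻¹' B, ?_, ?_⟩
  · refine mem_nhdsWithin.2 ⟨Metric.ball t r, Metric.isOpen_ball, Metric.mem_ball_self hr, ?_⟩
    rintro a ⟨ha, -, hb⟩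
    exact ⟨ha, hb⟩
  · have h1 := lintegral_image_eq_lintegral_abs_deriv_mul hs
      (fun x _ => (hy x).hasDerivWithinAt) (hinj.mono inter_subset_left) (fun _ => 1)
    have h2 : volume (y '' (Metric.ball t r ∩ y ⁻¹' B)) = 0 :=
      measure_mono_null (by rintro _ ⟨a, ha, rfl⟩; exact ha.2) hB0
    simp only [setLIntegral_one, h2, mul_one] at h1
    rw [eq_comm, lintegral_eq_zero_iff (by fun_prop), Filter.EventuallyEq,
      ae_restrict_iff' hs] at h1
    refine measure_mono_null (fun a ha => ?_) h1
    simp only [mem_compl_iff, mem_ofPred_eq, Classical.not_imp]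
    refine ⟨ha, ?_⟩
    simpa using hball ha.1

/-- Zeros with nonzero derivative are isolated, so locally the set is at most a point. -/
theorem volume_zeros_null_of_deriv_ne_zero {y h : ℝ → ℝ} (hy : ∀ t, HasDerivAt y (h t) t) :
    volume {t | y t = 0 ∧ h t ≠ 0} = 0 := by
  refine measure_null_of_locally_null _ fun t ht => ⟨{t}, ?_, by simp⟩
  have h1 := (hy t).eventually_ne (c := 0) ht.2
  rw [eventually_nhdsWithin_iff] at h1
  rw [mem_nhdsWithin_iff_eventually]
  filter_upwards [h1] with s hs hs'
  by_contra hne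
  exact hs hne hs'.1

/-! ### Geometry of the averaged potential -/

theorem latLen_sq (e : Fin 2 → ℤ) : latLen e ^ 2 = (e 0 : ℝ) ^ 2 + (e 1 : ℝ) ^ 2 := by
  rw [latLen, EuclideanSpace.norm_sq_eq, Fin.sum_univ_two]
  simp [latVec]

theorem latLen_pos {e : Fin 2 → ℤ} (he : e ≠ 0) : 0 < latLen e := by
  have h0 : 0 ≤ latLen e := norm_nonneg _
  refine lt_of_le_of_ne h0 fun h => he ?_
  have h1 := latLen_sq e
  rw [← h] at h1
  have h2 : (e 0 : ℝ) = 0 := by nlinarith [sq_nonneg (e 0 : ℝ), sq_nonneg (e 1 : ℝ)]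
  have h3 : (e 1 : ℝ) = 0 := by nlinarith [sq_nonneg (e 0 : ℝ), sq_nonneg (e 1 : ℝ)]
  ext i
  fin_cases i
  · exact_mod_cast h2
  · exact_mod_cast h3

theorem proj_latPerp (e : Fin 2 → ℤ) : proj (latPerp e) = 0 := by
  ext i
  fin_cases i
  · exact (AddCircle.coe_eq_zero_iff (1 : ℝ)).2 ⟨-e 1, by simp [latPerp]⟩
  · exact (AddCircle.coe_eq_zero_iff (1 : ℝ)).2 ⟨e 0, by simp [latPerp]⟩

theorem continuous_proj : Continuous proj :=
  continuous_pi fun i => (AddCircle.continuous_mk' (1 : ℝ)).comp (by fun_prop)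

theorem isOpenQuotientMap_proj : IsOpenQuotientMap proj := by
  have h : IsOpenQuotientMap (Pi.map fun (_ : Fin 2) (a : ℝ) => (a : UnitAddCircle)) :=
    IsOpenQuotientMap.piMap fun _ => QuotientAddGroup.isOpenQuotientMap_mk
  exact h.comp (EuclideanSpace.equiv (Fin 2) ℝ).toHomeomorph.isOpenQuotientMap

/-- Functions on the torus are periodic along closed geodesics directed by `𝔢^⊥`. -/
theorem periodic_along_perp {e : Fin 2 → ℤ} (he : e ≠ 0) {β : Type*} (g : Torus → β) (x : Torus) :
    Function.Periodic (fun s : ℝ => g (x + proj (s • ((1 / latLen e) • latPerp e))))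
      (latLen e) := by
  intro s
  have hL := (latLen_pos he).ne'
  have h : latLen e • ((1 / latLen e) • latPerp e) = latPerp e := by
    rw [smul_smul, mul_one_div_cancel hL, one_smul]
  simp only [add_smul, proj_add, h, proj_latPerp, add_zero]

theorem avg_eq (e : Fin 2 → ℤ) (V : Torus → ℝ) (x : Torus) :
    avg e V x = (1 / latLen e) *
      ∫ s in (0 : ℝ)..latLen e, V (x + proj (s • ((1 / latLen e) • latPerp e))) := by
  simp only [avg, smul_smul, mul_one_div]

theorem avg_add_perp {e : Fin 2 → ℤ} (he : e ≠ 0) (V : Torus → ℝ) (x : Torus) (t : ℝ) :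
    avg e V (x + proj (t • ((1 / latLen e) • latPerp e))) = avg e V x := by
  have h := (periodic_along_perp he V x).intervalIntegral_add_eq t 0
  rw [avg_eq, avg_eq]
  simp only [add_assoc, ← proj_add, ← add_smul]
  rw [intervalIntegral.integral_comp_add_left
    (fun s => V (x + proj (s • ((1 / latLen e) • latPerp e)))), add_zero, h, zero_add]

theorem torusGrad_avg_add_perp {e : Fin 2 → ℤ} (he : e ≠ 0) (V : Torus → ℝ) (x : Torus) (t : ℝ) :
    torusGrad (avg e V) (x + proj (t • ((1 / latLen e) • latPerp e))) = torusGrad (avg e V) x := by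
  simp only [torusGrad]
  congr 1
  ext v
  rw [add_right_comm, avg_add_perp he]

theorem differentiable_avg {V : Torus → ℝ} (hV : SmoothOnTorus V) (e : Fin 2 → ℤ) (x : Torus) :
    Differentiable ℝ (fun v : Plane => avg e V (x + proj v)) := by
  obtain ⟨w, rfl⟩ := proj_surjective x
  have h := ((contDiff_avg hV e).differentiable two_ne_zero).comp
    (differentiable_id.const_add w)
  simp only [Function.comp_def, proj_add] at h
  exact h

/-- The average is constant along `𝔢^⊥`; differentiate at time zero. -/
theorem inner_torusGrad_latPerp {V : Torus → ℝ} (hV : SmoothOnTorus V) {e : Fin 2 → ℤ}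
    (he : e ≠ 0) (x : Torus) : ⟪torusGrad (avg e V) x, latPerp e⟫ = 0 := by
  have hg := ((differentiable_avg hV e x) 0).hasGradientAt.hasFDerivAt
  have hl : HasDerivAt (fun t : ℝ => t • ((1 / latLen e) • latPerp e))
      ((1 / latLen e) • latPerp e) 0 := by
    simpa using (hasDerivAt_id (0 : ℝ)).smul_const ((1 / latLen e) • latPerp e)
  rw [← zero_smul ℝ ((1 / latLen e) • latPerp e)] at hg
  have h1 := hg.comp_hasDerivAt (0 : ℝ) hl
  have h2 := h1.unique ((hasDerivAt_const (0 : ℝ) (avg e V x)).congr_of_eventuallyEq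
    (Eventually.of_forall fun t => avg_add_perp he V x t))
  rw [zero_smul] at h2
  change ⟪torusGrad (avg e V) x, (1 / latLen e) • latPerp e⟫ = 0 at h2
  rw [inner_smul_right] at h2
  exact (mul_eq_zero.1 h2).resolve_left (one_div_pos.2 (latLen_pos he)).ne'

theorem inner_latVec (w : Plane) (e : Fin 2 → ℤ) : ⟪w, latVec e⟫ = w 0 * e 0 + w 1 * e 1 := by
  rw [EuclideanSpace.inner_eq_star_dotProduct]
  simp [latVec, dotProduct, Fin.sum_univ_two, mul_comm]

theorem inner_latPerp (w : Plane) (e : Fin 2 → ℤ) :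
    ⟪w, latPerp e⟫ = -(w 0 * e 1) + w 1 * e 0 := by
  rw [EuclideanSpace.inner_eq_star_dotProduct]
  simp [latPerp, dotProduct, Fin.sum_univ_two, mul_comm]

theorem eq_inner_smul_add {e : Fin 2 → ℤ} (he : e ≠ 0) (w : Plane) :
    w = ((1 / latLen e) * ⟪w, latVec e⟫) • ((1 / latLen e) • latVec e) +
      ((1 / latLen e) * ⟪w, latPerp e⟫) • ((1 / latLen e) • latPerp e) := by
  have hL := (latLen_pos he).ne'
  have h2 := latLen_sq e
  ext i
  fin_cases i
  · simp only [inner_latVec, inner_latPerp]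
    simp [latVec, latPerp]
    field_simp
    linear_combination (w 0) * h2
  · simp only [inner_latVec, inner_latPerp]
    simp [latVec, latPerp]
    field_simp
    linear_combination (w 1) * h2

theorem torusGrad_avg_eq_zero {V : Torus → ℝ} (hV : SmoothOnTorus V) {e : Fin 2 → ℤ}
    (he : e ≠ 0) (x : Torus) (h : ⟪torusGrad (avg e V) x, latVec e⟫ = 0) :
    torusGrad (avg e V) x = 0 := by
  rw [eq_inner_smul_add he (torusGrad (avg e V) x), h, inner_torusGrad_latPerp hV he]
  simp

theorem continuous_avg {V : Torus → ℝ} (hV : SmoothOnTorus V) (e : Fin 2 → ℤ) :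
    Continuous (avg e V) :=
  isOpenQuotientMap_proj.isQuotientMap.continuous_iff.2 (contDiff_avg hV e).continuous

theorem continuous_torusGrad_avg {V : Torus → ℝ} (hV : SmoothOnTorus V) (e : Fin 2 → ℤ) :
    Continuous (torusGrad (avg e V)) :=
  isOpenQuotientMap_proj.isQuotientMap.continuous_iff.2 (contDiff_torusGrad_proj hV e).continuous

theorem continuous_HLam (e : Fin 2 → ℤ) : Continuous (HLam e) := by
  unfold HLam
  fun_prop

theorem isClosed_Crit {V : Torus → ℝ} (hV : SmoothOnTorus V) (e : Fin 2 → ℤ) :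
    IsClosed (Crit e V) :=
  (isClosed_singleton.preimage (continuous_HLam e)).inter
    (isClosed_singleton.preimage ((continuous_torusGrad_avg hV e).comp continuous_fst))

theorem hamFlow_HPerp_mem_Crit {e : Fin 2 → ℤ} (he : e ≠ 0) (V : Torus → ℝ) (s : ℝ) (z : Phase) :
    hamFlow (HPerp e) s z ∈ Crit e V ↔ z ∈ Crit e V := by
  rw [hamFlow_HPerp]
  simp only [Crit, mem_ofPred_eq, torusGrad_avg_add_perp he]
  rfl

/-! ### Absolute continuity off the critical set -/

/-- A surjective linear map sends Lebesgue measure to a multiple of it; the projection and a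
translation of the torus then keep null sets null under preimage. -/
theorem quasiMeasurePreserving_translate_frame {e : Fin 2 → ℤ} (he : e ≠ 0) (x : Torus) :
    Measure.QuasiMeasurePreserving (fun q : ℝ × ℝ => x + proj
      (q.1 • ((1 / latLen e) • latVec e) + q.2 • ((1 / latLen e) • latPerp e)))
      (volume.prod volume) volume := by
  let T : ℝ × ℝ →ₗ[ℝ] Plane :=
    (LinearMap.fst ℝ ℝ ℝ).smulRight ((1 / latLen e) • latVec e) +
      (LinearMap.snd ℝ ℝ ℝ).smulRight ((1 / latLen e) • latPerp e)
  have hT : Function.Surjective T := fun w =>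
    ⟨((1 / latLen e) * ⟪w, latVec e⟫, (1 / latLen e) * ⟪w, latPerp e⟫),
      (eq_inner_smul_add he w).symm⟩
  obtain ⟨c, -, hc⟩ := T.exists_map_addHaar_eq_smul_addHaar
    (volume.prod volume) (volume : Measure Plane) hT
  have hq : Measure.QuasiMeasurePreserving T (volume.prod volume) volume :=
    ⟨T.continuous_of_finiteDimensional.measurable, by
      rw [hc]; exact Measure.smul_absolutelyContinuous⟩
  exact (measurePreserving_add_left volume x).quasiMeasurePreserving.comp
    (quasiMeasurePreserving_proj.comp hq)

theorem orbit_noncritical_null {V : Torus → ℝ} (hV : SmoothOnTorus V) {e : Fin 2 → ℤ}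
    (he : e ≠ 0) {N : Set Torus} (hN : MeasurableSet N) (hN0 : volume N = 0) (z : Phase) :
    ∀ᵐ t : ℝ, volume {s : ℝ | hamFlow (HPerp e) s (hamFlow (pLam e V) t z) ∈
      (Crit e V)ᶜ ∩ Prod.fst ⁻¹' N} = 0 := by
  obtain ⟨c, hc0, hc⟩ := isFlow_hamFlow_pLam hV e z
  have hL := latLen_pos he
  set v : Plane := (1 / latLen e) • latVec e with hv
  set u : Plane := (1 / latLen e) • latPerp e with hu
  set h : ℝ → ℝ := fun t => HLam e (hamFlow (pLam e V) t z) with hh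
  set y : ℝ → ℝ := fun t => ⟪(c t).1, v⟫ with hy
  have hvv : ⟪v, v⟫ = 1 := by
    rw [real_inner_self_eq_norm_sq, hv, norm_smul, ← latLen, norm_div, norm_one,
      Real.norm_of_nonneg hL.le, one_div_mul_cancel hL.ne', one_pow]
  have hd1 : ∀ t, HasDerivAt (fun t => (c t).1) (h t • v) t := fun t => by
    have h1 := (hc t).2
    rw [hamField_pLam] at h1
    have h2 := (hasFDerivAt_fst (𝕜 := ℝ) (p := c t)).comp_hasDerivAt t h1
    refine h2.congr_deriv ?_
    simp [hh, hv, smul_smul, div_eq_mul_inv]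
  have hd2 : ∀ t, HasDerivAt (fun t => (c t).2)
      (-torusGrad (avg e V) (hamFlow (pLam e V) t z).1) t := fun t => by
    have h1 := (hc t).2
    rw [hamField_pLam] at h1
    exact (hasFDerivAt_snd (𝕜 := ℝ) (p := c t)).comp_hasDerivAt t h1
  have hyd : ∀ t, HasDerivAt y (h t) t := fun t => by
    have h1 := (hd1 t).inner ℝ (hasDerivAt_const t v)
    refine h1.congr_deriv ?_
    rw [inner_zero_right, zero_add, real_inner_smul_left, hvv, mul_one]
  have hhd : ∀ t, HasDerivAt h
      ((1 / latLen e) * ⟪-torusGrad (avg e V) (hamFlow (pLam e V) t z).1, latVec e⟫) t :=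
    fun t => by
      have h1 := ((hd2 t).inner ℝ (hasDerivAt_const t (latVec e))).const_mul (1 / latLen e)
      rw [inner_zero_right, zero_add] at h1
      refine h1.congr_of_eventuallyEq (Eventually.of_forall fun s => ?_)
      simp only [hh, HLam, (hc s).1]
  -- The velocity is always parallel to `v`, so the lifted base curve stays on a line through the
  -- origin.
  have hcy : ∀ t, (c t).1 = y t • v := fun t => by
    have hd : ∀ t, HasDerivAt (fun t => (c t).1 - y t • v) 0 t := fun t => by
      have h1 := (hd1 t).sub ((hyd t).smul_const v)
      rwa [sub_self] at h1
    have h3 := is_const_of_deriv_eq_zero (fun t => (hd t).differentiableAt)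
      (fun t => (hd t).deriv) t 0
    rw [← sub_eq_zero, h3]
    simp [hy, hc0]
  let S : Set (ℝ × ℝ) := (fun q : ℝ × ℝ => z.1 + proj (q.1 • v + q.2 • u)) ⁻¹' N
  have hq := quasiMeasurePreserving_translate_frame he z.1
  have hS : MeasurableSet S := hN.preimage hq.measurable
  have hS0 : (volume.prod volume) S = 0 := hq.preimage_null hN0
  -- Abscissas of the lines along `u` that meet `N` in positive length; Fubini makes them
  -- negligible.
  let B : Set ℝ := {a | volume (Prod.mk a ⁻¹' S) ≠ 0}
  have hB : MeasurableSet B :=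
    (measurableSet_singleton (0 : ENNReal)).compl.preimage (measurable_measure_prodMk_left hS)
  have hB0 : volume B = 0 := (Measure.measure_prod_null hS).1 hS0
  have n1 := volume_preimage_null_of_deriv_ne_zero hyd
    (continuous_iff_continuousAt.2 fun t => (hhd t).continuousAt) hB hB0
  have n2 := volume_zeros_null_of_deriv_ne_zero hhd
  filter_upwards [compl_mem_ae_iff.2 n1, compl_mem_ae_iff.2 n2] with t h1 h2
  by_cases h0 : h t = 0
  -- Outside the null set of `n2`, a zero of `h` is also a zero of its derivative, which forces the
  -- orbit to be critical.
  · have h3 : ⟪torusGrad (avg e V) (hamFlow (pLam e V) t z).1, latVec e⟫ = 0 := by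
      by_contra hne
      refine h2 ⟨h0, mul_ne_zero (one_div_pos.2 hL).ne' ?_⟩
      rwa [inner_neg_left, neg_ne_zero]
    have h4 : hamFlow (pLam e V) t z ∈ Crit e V := ⟨h0, torusGrad_avg_eq_zero hV he _ h3⟩
    refine measure_mono_null (fun s hs => ?_) measure_empty
    exact hs.1 ((hamFlow_HPerp_mem_Crit he V s _).2 h4)
  · have h3 : y t ∉ B := fun hb => h1 ⟨h0, hb⟩
    refine measure_mono_null (fun s hs => ?_) (not_not.1 h3)
    have h4 := hs.2
    rw [mem_preimage, hamFlow_HPerp, (hc t).1, hcy t, add_assoc, ← proj_add] at h4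
    exact h4

/-- Fubini on (times) × (phase space): each point enters the bad set only for a null set of time
pairs, so for almost every pair the preimage of the bad set is null. One such pair suffices, since
both flows preserve `μ`. -/
theorem measure_noncritical_null {V : Torus → ℝ} (hV : SmoothOnTorus V) {e : Fin 2 → ℤ}
    (he : e ≠ 0) {μ : Measure Phase} [SFinite μ]
    (hμH : ∀ t : ℝ, MeasurePreserving (hamFlow (HPerp e) t) μ μ)
    (hμp : ∀ t : ℝ, MeasurePreserving (hamFlow (pLam e V) t) μ μ)
    {N : Set Torus} (hN : MeasurableSet N) (hN0 : volume N = 0) :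
    μ ((Crit e V)ᶜ ∩ Prod.fst ⁻¹' N) = 0 := by
  set A : Set Phase := (Crit e V)ᶜ ∩ Prod.fst ⁻¹' N with hA
  have hAm : MeasurableSet A :=
    (isClosed_Crit hV e).measurableSet.compl.inter (hN.preimage measurable_fst)
  let Φ : (ℝ × ℝ) × Phase → Phase := fun q =>
    hamFlow (HPerp e) q.1.2 (hamFlow (pLam e V) q.1.1 q.2)
  have hp : Measurable (Function.uncurry (hamFlow (pLam e V))) := by
    -- Joint measurability comes from continuity in time and from the measurability in `z` contained
    -- in `hμp`.
    refine measurable_uncurry_of_continuous_of_measurable (fun z => ?_) fun t => (hμp t).measurable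
    obtain ⟨c, -, hc⟩ := isFlow_hamFlow_pLam hV e z
    have hcc : Continuous c := continuous_iff_continuousAt.2 fun t => (hc t).2.continuousAt
    simp only [fun t => (hc t).1]
    exact (continuous_const.add (continuous_proj.comp hcc.fst)).prodMk hcc.snd
  have hH : Measurable fun q : ℝ × Phase => hamFlow (HPerp e) q.1 q.2 := by
    simp only [hamFlow_HPerp]
    have := continuous_proj
    exact Continuous.measurable (by fun_prop)
  have hΦ : Measurable Φ :=
    hH.comp (measurable_fst.snd.prodMk (hp.comp (measurable_fst.fst.prodMk measurable_snd)))
  have hΦA : MeasurableSet (Φ ⁻¹' A) := hAm.preimage hΦ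
  have h0 : ((volume.prod volume : Measure (ℝ × ℝ)).prod μ) (Φ ⁻¹' A) = 0 := by
    rw [Measure.prod_apply_symm hΦA, lintegral_eq_zero_iff (measurable_measure_prodMk_right hΦA)]
    refine Eventually.of_forall fun z => ?_
    have hm : MeasurableSet ((fun q : ℝ × ℝ => (q, z)) ⁻¹' (Φ ⁻¹' A)) :=
      hΦA.preimage measurable_prodMk_right
    exact (Measure.measure_prod_null hm).2 (orbit_noncritical_null hV he hN hN0 z)
  obtain ⟨q, hq⟩ := ((Measure.measure_prod_null hΦA).1 h0).exists
  exact (((hμH q.2).comp (hμp q.1)).measure_preimage hAm.nullMeasurableSet).symm.trans hq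

/-! ### Disintegration of invariant measures along closed geodesics -/

theorem integral_orbitMeasure {e : Fin 2 → ℤ} (he : e ≠ 0) {g : Torus → ℝ} (hg : Continuous g)
    (z : Phase) : ∫ x, g x ∂(orbitMeasure e z) = avg e g z.1 := by
  have hL := latLen_pos he
  have hc := continuous_proj
  have hm : Continuous fun s : ℝ => (hamFlow (HPerp e) s z).1 := by
    simp only [hamFlow_HPerp]
    fun_prop
  rw [orbitMeasure, integral_smul_measure, integral_map hm.aemeasurable hg.aestronglyMeasurable,
    avg_eq, intervalIntegral.integral_of_le hL.le, ENNReal.toReal_inv,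
    ENNReal.toReal_ofReal hL.le, smul_eq_mul, one_div]
  simp only [hamFlow_HPerp, one_div]

theorem isProbabilityMeasure_orbitMeasure {e : Fin 2 → ℤ} (he : e ≠ 0) (z : Phase) :
    IsProbabilityMeasure (orbitMeasure e z) := by
  have hL := latLen_pos he
  have hc := continuous_proj
  have hm : Continuous fun s : ℝ => (hamFlow (HPerp e) s z).1 := by
    simp only [hamFlow_HPerp]
    fun_prop
  refine ⟨?_⟩
  rw [orbitMeasure, Measure.smul_apply, Measure.map_apply hm.measurable MeasurableSet.univ]
  simp only [preimage_univ, Measure.restrict_apply_univ, Real.volume_Ioc, sub_zero, smul_eq_mul]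
  exact ENNReal.inv_mul_cancel (by simpa using hL) ENNReal.ofReal_ne_top

theorem continuous_avg_of_continuous {g : Torus → ℝ} (hg : Continuous g) (e : Fin 2 → ℤ) :
    Continuous (avg e g) := by
  have hc := continuous_proj
  unfold avg
  exact continuous_const.mul
    (intervalIntegral.continuous_parametric_intervalIntegral_of_continuous'
      (by simp only [Function.uncurry_def]; fun_prop) _ _)

/-- Exchange the integrals; by invariance each translate of `g` has the same integral. -/
theorem integral_avg {e : Fin 2 → ℤ} (he : e ≠ 0) {σ : Measure Torus} [IsFiniteMeasure σ]
    (hσ : ∀ s : ℝ, MeasurePreserving (fun x => x + proj (s • ((1 / latLen e) • latPerp e))) σ σ)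
    {g : Torus → ℝ} (hg : Continuous g) : ∫ x, avg e g x ∂σ = ∫ x, g x ∂σ := by
  have hL := latLen_pos he
  have hc := continuous_proj
  obtain ⟨M, hM⟩ := isCompact_univ.exists_bound_of_continuousOn hg.continuousOn
  have hc2 : Continuous fun q : Torus × ℝ =>
      g (q.1 + proj (q.2 • ((1 / latLen e) • latPerp e))) := by fun_prop
  have hint : Integrable (Function.uncurry fun (x : Torus) (s : ℝ) =>
      g (x + proj (s • ((1 / latLen e) • latPerp e))))
      (σ.prod (volume.restrict (Ioc 0 (latLen e)))) :=
    Integrable.of_bound hc2.aestronglyMeasurable M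
      (Eventually.of_forall fun q => hM _ (mem_univ _))
  have hs : ∀ s : ℝ, ∫ x, g (x + proj (s • ((1 / latLen e) • latPerp e))) ∂σ = ∫ x, g x ∂σ :=
    fun s => by
      conv_rhs => rw [← (hσ s).map_eq]
      exact (integral_map (hσ s).measurable.aemeasurable hg.aestronglyMeasurable).symm
  simp only [avg_eq, intervalIntegral.integral_of_le hL.le]
  rw [integral_const_mul, integral_integral_swap hint]
  simp only [hs, setIntegral_const]
  rw [smul_eq_mul, measureReal_def, Real.volume_Ioc, sub_zero, ENNReal.toReal_ofReal hL.le,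
    ← mul_assoc, one_div_mul_cancel hL.ne', one_mul]

/-- A maximum on the compact torus is critical. This provides a base point for the approximation and
an element of `𝒩(Λ)` when the critical set has measure zero. -/
theorem exists_torusGrad_avg_eq_zero {V : Torus → ℝ} (hV : SmoothOnTorus V) (e : Fin 2 → ℤ) :
    ∃ x, torusGrad (avg e V) x = 0 := by
  obtain ⟨x, -, hx⟩ := isCompact_univ.exists_isMaxOn (univ_nonempty (α := Torus))
    (continuous_avg hV e).continuousOn
  refine ⟨x, ?_⟩
  have h : IsLocalMax (fun v : Plane => avg e V (x + proj v)) 0 := by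
    refine Eventually.of_forall fun v => ?_
    have h0 : proj (0 : Plane) = 0 := by ext i; simp [proj]
    simp only [h0, add_zero]
    exact hx (mem_univ _)
  rw [torusGrad, gradient, h.fderiv_eq_zero, map_zero]

/-- The measure `δ_{Π∘Γ}` for the orbit `Γ` of `(x, 0)`, as a finite measure. -/
def orbitFiniteMeasure {e : Fin 2 → ℤ} (he : e ≠ 0) (x : Torus) : FiniteMeasure Torus :=
  ⟨orbitMeasure e (x, 0), by
    have := isProbabilityMeasure_orbitMeasure he ((x, 0) : Phase)
    infer_instance⟩

theorem mem_Crit_zero_iff {e : Fin 2 → ℤ} {V : Torus → ℝ} {x : Torus} :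
    ((x, 0) : Phase) ∈ Crit e V ↔ torusGrad (avg e V) x = 0 := by
  simp [Crit, HLam]

theorem orbitFiniteMeasure_mem {e : Fin 2 → ℤ} (he : e ≠ 0) {V : Torus → ℝ} {x : Torus}
    (hx : torusGrad (avg e V) x = 0) :
    orbitFiniteMeasure he x ∈ {m : FiniteMeasure Torus | ∃ z : Phase,
      (∀ s : ℝ, hamFlow (HPerp e) s z ∈ Crit e V) ∧ (m : Measure Torus) = orbitMeasure e z} :=
  ⟨(x, 0), fun s => (hamFlow_HPerp_mem_Crit he V s _).2 (mem_Crit_zero_iff.2 hx), rfl⟩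

theorem NLam_nonempty {V : Torus → ℝ} (hV : SmoothOnTorus V) {e : Fin 2 → ℤ} (he : e ≠ 0) :
    (NLam e V).Nonempty := by
  obtain ⟨x, hx⟩ := exists_torusGrad_avg_eq_zero hV e
  exact ⟨_, subset_closure (subset_convexHull ℝ≥0 _ (orbitFiniteMeasure_mem he hx))⟩

theorem integral_finset_sum_finiteMeasure {Ω ι : Type*} [MeasurableSpace Ω] [TopologicalSpace Ω]
    [OpensMeasurableSpace Ω] (t : Finset ι) (w : ι → ℝ≥0) (m : ι → FiniteMeasure Ω)
    (g : BoundedContinuousFunction Ω ℝ) :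
    ∫ x, g x ∂((∑ i ∈ t, w i • m i : FiniteMeasure Ω) : Measure Ω) =
      ∑ i ∈ t, (w i : ℝ) * ∫ x, g x ∂(m i : Measure Ω) := by
  rw [FiniteMeasure.toMeasure_sum, integral_finsetSum_measure fun i _ => g.integrable _]
  refine Finset.sum_congr rfl fun i _ => ?_
  rw [FiniteMeasure.toMeasure_smul, integral_smul_nnreal_measure, NNReal.smul_def, smul_eq_mul]

theorem integral_comp_simpleFunc {Ω β : Type*} [MeasurableSpace Ω] (σ : Measure Ω)
    [IsFiniteMeasure σ] (f : SimpleFunc Ω β) (h : β → ℝ) :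
    ∫ x, h (f x) ∂σ = ∑ y ∈ f.range, σ.real (f ⁻¹' {y}) * h y := by
  classical
  have h1 : ∀ x, h (f x) = ∑ y ∈ f.range, (f ⁻¹' {y}).indicator (fun _ : Ω => h y) x := fun x => by
    rw [Finset.sum_eq_single (f x)]
    · simp
    · intro y _ hy
      exact indicator_of_notMem (fun hx : f x = y => hy hx.symm) _
    · exact fun hx => absurd (f.mem_range_self x) hx
  simp only [h1]
  rw [integral_finsetSum _ fun y _ =>
    (integrable_const (h y)).indicator (f.measurableSet_preimage {y})]
  refine Finset.sum_congr rfl fun y _ => ?_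
  rw [integral_indicator_const _ (f.measurableSet_preimage {y}), smul_eq_mul]

/-- A probability measure invariant under the translations along `𝔢^⊥` and carried by the critical
points of the averaged potential belongs to `𝒩(Λ)`. -/
theorem mem_NLam_of_invariant {V : Torus → ℝ} (hV : SmoothOnTorus V) {e : Fin 2 → ℤ} (he : e ≠ 0)
    (σ : FiniteMeasure Torus) [hP : IsProbabilityMeasure (σ : Measure Torus)]
    (hσ : ∀ s : ℝ, MeasurePreserving (fun x => x + proj (s • ((1 / latLen e) • latPerp e)))
      (σ : Measure Torus) σ)
    (hC : ∀ᵐ x ∂(σ : Measure Torus), torusGrad (avg e V) x = 0) : σ ∈ NLam e V := by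
  obtain ⟨x₀, hx₀⟩ := exists_torusGrad_avg_eq_zero hV e
  set C : Set Torus := {x | torusGrad (avg e V) x = 0}
  have hx₀' : x₀ ∈ C := hx₀
  -- Simple functions approximating the identity with all values in `C`, so that every atom below is
  -- an orbit measure allowed in `𝒩(Λ)`.
  let f : ℕ → SimpleFunc Torus Torus := SimpleFunc.approxOn id measurable_id C x₀ hx₀'
  have hfC : ∀ n x, f n x ∈ C := fun n x => SimpleFunc.approxOn_mem measurable_id hx₀' n x
  have hflim : ∀ x ∈ C, Tendsto (fun n => f n x) atTop (𝓝 x) := fun x hx =>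
    SimpleFunc.tendsto_approxOn measurable_id hx₀' (subset_closure hx)
  let m : ℕ → FiniteMeasure Torus := fun n =>
    ∑ y ∈ (f n).range, σ (f n ⁻¹' {y}) • orbitFiniteMeasure he y
  have hmass : ∀ n, ∑ y ∈ (f n).range, σ (f n ⁻¹' {y}) = 1 := fun n => by
    have h := (f n).sum_range_measure_preimage_singleton (σ : Measure Torus)
    rw [measure_univ] at h
    rw [← ENNReal.coe_inj, ENNReal.ofNNReal_finsetSum, ENNReal.coe_one, ← h]
    exact Finset.sum_congr rfl fun y _ => FiniteMeasure.ennreal_coeFn_eq_coeFn_toMeasure _ _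
  refine mem_closure_of_tendsto (f := m) (b := atTop) ?_ (Eventually.of_forall fun n => ?_)
  · rw [FiniteMeasure.tendsto_iff_forall_integral_tendsto]
    intro g
    have hA := continuous_avg_of_continuous g.continuous e
    have hb : ∀ x, ‖avg e g x‖ ≤ ‖g‖ := fun x => by
      have := isProbabilityMeasure_orbitMeasure he ((x, 0) : Phase)
      rw [← integral_orbitMeasure he g.continuous ((x, 0) : Phase)]
      exact g.norm_integral_le_norm _
    have h1 : ∀ n, ∫ x, g x ∂(m n : Measure Torus) = ∫ x, avg e g (f n x) ∂(σ : Measure Torus) :=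
      fun n => by
        rw [integral_finset_sum_finiteMeasure, integral_comp_simpleFunc]
        exact Finset.sum_congr rfl fun y _ => congrArg _
          (integral_orbitMeasure he g.continuous ((y, 0) : Phase))
    simp only [h1]
    -- Both sides are now integrals of the continuous function `avg e g`, at `f n x` and at `x`;
    -- dominated convergence applies.
    rw [← integral_avg he hσ g.continuous]
    refine tendsto_integral_of_dominated_convergence (fun _ => ‖g‖)
      (fun n => (hA.measurable.comp (f n).measurable).aestronglyMeasurable)
      (integrable_const _) (fun n => Eventually.of_forall fun x => hb _) ?_
    filter_upwards [hC] with x hx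
    exact (hA.tendsto x).comp (hflim x hx)
  · exact sum_smul_mem_of_convex (convex_convexHull _ _) _ _ _ (hmass n) fun y hy => by
      obtain ⟨x, rfl⟩ := SimpleFunc.mem_range.1 hy
      exact subset_convexHull _ _ (orbitFiniteMeasure_mem he (hfC n x))

theorem ne_zero_of_isPrimitiveRankOne {Λ : AddSubgroup (Fin 2 → ℤ)} (hΛ : IsPrimitiveRankOne Λ)
    {e : Fin 2 → ℤ} (he : AddSubgroup.zmultiples e = Λ) : e ≠ 0 := by
  rintro rfl
  have h := hΛ.1
  have h0 : latVec 0 = 0 := by ext i; fin_cases i <;> simp [latVec]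
  have h1 : latVec '' (Λ : Set (Fin 2 → ℤ)) = {0} := by
    rw [← he, AddSubgroup.zmultiples_zero_eq_bot]
    simp [h0]
  rw [h1, Submodule.span_zero_singleton, finrank_bot] at h
  exact zero_ne_one h

end TorusBiinv

end

open TorusBiinv in
theorem corollaryA3 (V : Torus → ℝ) (hV : SmoothOnTorus V)
    (Λ : AddSubgroup (Fin 2 → ℤ)) (hΛ : IsPrimitiveRankOne Λ)
    (e : Fin 2 → ℤ) (he : AddSubgroup.zmultiples e = Λ)
    (μ : Measure Phase) [IsProbabilityMeasure μ]
    (hμH : ∀ t : ℝ, MeasurePreserving (hamFlow (HPerp e) t) μ μ)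
    (hμp : ∀ t : ℝ, MeasurePreserving (hamFlow (pLam e V) t) μ μ) :
    ∃ (f : Torus → ℝ) (α : ℝ) (νsing : FiniteMeasure Torus),
      Integrable f volume ∧ (∀ x, 0 ≤ f x) ∧ α ∈ Icc (0 : ℝ) 1 ∧ νsing ∈ NLam e V ∧
      μ.map Prod.fst =
        volume.withDensity (fun x => ENNReal.ofReal (f x)) +
          ENNReal.ofReal α • (νsing : Measure Torus) := by
  have he0 := ne_zero_of_isPrimitiveRankOne hΛ he
  have hCm : MeasurableSet (Crit e V) := (isClosed_Crit hV e).measurableSet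
  set ρ : Measure Torus := (μ.restrict (Crit e V)ᶜ).map Prod.fst with hρ
  set m : Measure Torus := (μ.restrict (Crit e V)).map Prod.fst with hm
  have hsplit : μ.map Prod.fst = ρ + m := by
    rw [hρ, hm, ← Measure.map_add _ _ measurable_fst, add_comm,
      Measure.restrict_add_restrict_compl hCm]
  have hac : ρ ≪ volume := Measure.AbsolutelyContinuous.mk fun N hN hN0 => by
    rw [hρ, Measure.map_apply measurable_fst hN,
      Measure.restrict_apply (hN.preimage measurable_fst), inter_comm]
    exact measure_noncritical_null hV he0 hμH hμp hN hN0
  have hdens : volume.withDensity (fun x => ENNReal.ofReal (ρ.rnDeriv volume x).toReal) = ρ := by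
    conv_rhs => rw [← Measure.withDensity_rnDeriv_eq ρ volume hac]
    -- The derivative is finite almost everywhere, so passing to real values loses nothing.
    refine withDensity_congr_ae ?_
    filter_upwards [Measure.rnDeriv_lt_top ρ volume] with x hx
    exact ENNReal.ofReal_toReal hx.ne
  have hmuniv : m univ = μ (Crit e V) := by
    rw [hm, Measure.map_apply measurable_fst MeasurableSet.univ, preimage_univ,
      Measure.restrict_apply_univ]
  have hα : μ.real (Crit e V) ∈ Icc (0 : ℝ) 1 := ⟨measureReal_nonneg, measureReal_le_one⟩
  suffices H : ∃ ν : FiniteMeasure Torus, ν ∈ NLam e V ∧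
      m = ENNReal.ofReal (μ.real (Crit e V)) • (ν : Measure Torus) by
    obtain ⟨ν, hν, h⟩ := H
    exact ⟨fun x => (ρ.rnDeriv volume x).toReal, μ.real (Crit e V), ν,
      Measure.integrable_toReal_rnDeriv, fun x => ENNReal.toReal_nonneg, hα, hν, by
        rw [hsplit, hdens, ← h]⟩
  rw [ofReal_measureReal]
  rcases eq_or_ne (μ (Crit e V)) 0 with h0 | h0
  -- With `α = 0` the singular measure is arbitrary, but it must still lie in `𝒩(Λ)`.
  · obtain ⟨ν, hν⟩ := NLam_nonempty hV he0
    refine ⟨ν, hν, ?_⟩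
    rw [h0, zero_smul, ← Measure.measure_univ_eq_zero, hmuniv, h0]
  have htop : μ (Crit e V) ≠ ⊤ := measure_ne_top μ _
  have hP : IsProbabilityMeasure ((μ (Crit e V))⁻¹ • m) := ⟨by
    rw [Measure.smul_apply, hmuniv, smul_eq_mul, ENNReal.inv_mul_cancel h0 htop]⟩
  refine ⟨⟨(μ (Crit e V))⁻¹ • m, inferInstance⟩, ?_, ?_⟩
  · refine mem_NLam_of_invariant hV he0 _ (hP := hP) (fun s => ?_) ?_
    · have hT : Measurable fun x : Torus => x + proj (s • ((1 / latLen e) • latPerp e)) :=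
        measurable_id.add_const _
      refine MeasurePreserving.smul_measure (μa := m) (μb := m) ⟨hT, ?_⟩ _
      -- `Crit e V` is invariant under the flow of `H_Λ^⊥`, so the restricted measure is too; the
      -- projection carries this flow to translation along `𝔢^⊥`.
      have h1 := (hμH s).restrict_preimage hCm
      have h2 : hamFlow (HPerp e) s ⁻¹' Crit e V = Crit e V :=
        Set.ext fun z => hamFlow_HPerp_mem_Crit he0 V s z
      rw [h2] at h1
      conv_rhs => rw [hm, ← h1.map_eq]
      rw [hm, Measure.map_map hT measurable_fst, Measure.map_map measurable_fst h1.measurable]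
      congr 1
      ext1 z
      simp only [Function.comp_apply, hamFlow_HPerp]
    · refine Measure.ae_smul_measure ?_ _
      have hcl : MeasurableSet {x : Torus | torusGrad (avg e V) x = 0} :=
        (isClosed_singleton.preimage (continuous_torusGrad_avg hV e)).measurableSet
      rw [hm, ae_map_iff measurable_fst.aemeasurable hcl]
      filter_upwards [ae_restrict_mem hCm] with z hz
      exact hz.2
  · change m = _ • (_ • m)
    rw [smul_smul, ENNReal.mul_inv_cancel h0 htop, one_smul]
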